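/- Let $A$ be a complex Banach algebra (for instance a $C^*$-algebra), not necessarily unital, and let $A^1=\mathbb C\oplus A$ be its unitization. Let $E$ be a Banach right module over $A$, i.e. a complex Banach space with a bounded bilinear map $E\times A\to E$, $(x,a)\mapsto xa$, such that $x(ab)=(xa)b$; then $A^1$ acts on $E$ by $x(c,a)=cx+xa$. A right submodule $W\subseteq E$ (a linear subspace with $WA\subseteq W$) is called *algebraically $\kappa$-generated*, for a cardinal $\kappa$, if there is a set $S\subseteq W$ of cardinality at most $\kappa$ such that every element of $W$ is a finite sum $\sum_{k=1}^n v_ka_k$ with $v_k\in S$ and $a_k\in A^1$. It is *algebraically countably generated* if it is algebraically $\aleph_0$-generated, and *algebraically finitely generated* if $S$ can be chosen finite. Let $\mathfrak p$ be the least cardinality of a family of dense open subsets of $\mathbb R$ whose intersection is not dense in $\mathbb R$. Let $W$ be a closed right submodule of $E$. 1. If $W$ is algebraically countably generated, then $W$ is algebraically finitely generated. 2. If $W$ is separable and algebraically $\kappa$-generated for some cardinal $\kappa<\mathfrak p$, then $W$ is algebraically finitely generated. -/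

import Mathlib

universe u v

/-- A right module structure over a (not necessarily unital) normed algebra `A` on a normed space
`E`, with jointly continuous action: a bounded bilinear map `(x, a) ↦ x a` such that
`x (a b) = (x a) b`. If `E` is complete, `E` is a Banach right `A`-module.
The module is not assumed to be contractive, unital or essential. -/
class NormedRightModule (A : Type u) (E : Type v) [NonUnitalNormedRing A] [NormedSpace ℂ A]
    [NormedAddCommGroup E] [NormedSpace ℂ E] where
  /-- The action: `act x a` is the product `x a`. -/
  act : E →L[ℂ] A →L[ℂ] E
  act_mul : ∀ (x : E) (a b : A), act x (a * b) = act (act x a) b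

section

variable (A : Type u) {E : Type v} [NonUnitalNormedRing A] [NormedSpace ℂ A]
  [NormedAddCommGroup E] [NormedSpace ℂ E] [NormedRightModule A E]

variable {A} in
/-- The induced right action of the unitization `A¹ = ℂ ⊕ A`: `x (c, a) = c x + x a`. -/
noncomputable def unitizationAct (x : E) (u : Unitization ℂ A) : E :=
  u.fst • x + NormedRightModule.act x u.snd

/-- The linear subspace `W` of `E` is a right `A`-submodule. -/
def IsRightSubmodule (W : Submodule ℂ E) : Prop :=
  ∀ x ∈ W, ∀ a : A, NormedRightModule.act x a ∈ W

/-- `S` is a set of algebraic generators of the submodule `W`: it lies in `W`, and every element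
of `W` is a finite sum `∑ k, v k * a k` with `v k ∈ S` and coefficients `a k` in `A¹`. -/
def IsAlgGeneratingSet (S : Set E) (W : Submodule ℂ E) : Prop :=
  S ⊆ W ∧ ∀ x ∈ W, ∃ (n : ℕ) (w : Fin n → E) (a : Fin n → Unitization ℂ A),
    (∀ k, w k ∈ S) ∧ x = ∑ k, unitizationAct (w k) (a k)

/-- `W` is algebraically `κ`-generated. -/
def IsAlgGenerated (κ : Cardinal.{v}) (W : Submodule ℂ E) : Prop :=
  ∃ S : Set E, Cardinal.mk S ≤ κ ∧ IsAlgGeneratingSet A S W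

/-- `W` is algebraically countably generated. -/
def IsAlgCountablyGenerated (W : Submodule ℂ E) : Prop :=
  IsAlgGenerated A Cardinal.aleph0 W

/-- `W` is algebraically finitely generated. -/
def IsAlgFinitelyGenerated (W : Submodule ℂ E) : Prop :=
  ∃ S : Set E, S.Finite ∧ IsAlgGeneratingSet A S W

end

/-- The cardinal `𝔭`: the least cardinality of a family of dense open subsets of `ℝ`
whose intersection is not dense. -/
noncomputable def cardinalP : Cardinal.{0} :=
  sInf {c : Cardinal.{0} | ∃ (ι : Type) (U : ι → Set ℝ), Cardinal.mk ι = c ∧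
    (∀ i, IsOpen (U i) ∧ Dense (U i)) ∧ ¬ Dense (⋂ i, U i)}

/-! Each finite tuple `w` of generators gives a bounded operator from tuples over `A¹` to `W`, and
the ranges of these operators cover `W`. Replacing each range by the closures of the images of the
balls of radius `m : ℕ` gives a closed cover. If one of its members has interior, the open mapping
argument makes that operator surjective, so the entries of one tuple generate `W`.

For countably many generators the cover is countable and Baire's theorem applies. For fewer than `𝔭`
generators the cover has fewer than `𝔭` members, and Baire's theorem for that many sets must be
carried from `ℝ` to the separable space `W`. The binary digits of a real code a decreasing sequence
of closed sets from a countable family. Entering a given dense open set, or having small diameter,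
occurs for a dense open set of reals, so some real meets all these requirements, and completeness
gives the common point. -/

open Set Metric Filter Topology

/-! ### A bounded operator with non-meagre range is surjective -/

namespace ContinuousLinearMap

variable {X Y : Type*} [NormedAddCommGroup X] [NormedSpace ℝ X] [NormedAddCommGroup Y]
  [NormedSpace ℝ Y]

/-- Correcting the remaining error again and again halves it each time, so the corrections form a
geometrically convergent series. Only the domain has to be complete. -/
theorem surjective_of_approx_preimage [CompleteSpace X] (f : X →L[ℝ] Y) {C : ℝ}
    (hC : ∀ y, ∃ x, ‖y - f x‖ ≤ 1 / 2 * ‖y‖ ∧ ‖x‖ ≤ C * ‖y‖) : Function.Surjective f := by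
  choose g hg using hC
  intro y
  let h : Y → Y := fun y => y - f (g y)
  have hnle : ∀ n : ℕ, ‖h^[n] y‖ ≤ (1 / 2) ^ n * ‖y‖ := by
    intro n
    induction n with
    | zero => simp
    | succ n ih =>
      rw [Function.iterate_succ_apply', pow_succ', mul_assoc]
      exact (hg _).1.trans (by gcongr)
  have ule : ∀ n, ‖g (h^[n] y)‖ ≤ (1 / 2) ^ n * (|C| * ‖y‖) := fun n =>
    calc ‖g (h^[n] y)‖ ≤ C * ‖h^[n] y‖ := (hg _).2
      _ ≤ |C| * ((1 / 2) ^ n * ‖y‖) :=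
        mul_le_mul (le_abs_self C) (hnle n) (norm_nonneg _) (abs_nonneg _)
      _ = (1 / 2) ^ n * (|C| * ‖y‖) := by ring
  have su : Summable fun n => g (h^[n] y) :=
    Summable.of_norm_bounded (summable_geometric_two.mul_right _) ule
  have fsum : ∀ n : ℕ, f (∑ i ∈ Finset.range n, g (h^[i] y)) = y - h^[n] y := by
    intro n
    induction n with
    | zero => simp
    | succ n ih =>
      rw [Finset.sum_range_succ, map_add, ih, Function.iterate_succ_apply', sub_add]
  have L₁ := (f.continuous.tendsto _).comp su.hasSum.tendsto_sum_nat
  have L₀ : Tendsto (fun n => h^[n] y) atTop (𝓝 0) := by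
    refine squeeze_zero_norm hnle ?_
    rw [← zero_mul ‖y‖]
    exact (tendsto_pow_atTop_nhds_zero_of_lt_one (by norm_num) (by norm_num)).mul_const _
  have L₂ : Tendsto (fun n => y - h^[n] y) atTop (𝓝 (y - 0)) := tendsto_const_nhds.sub L₀
  refine ⟨_, (tendsto_nhds_unique (L₁.congr fsum) L₂).trans (sub_zero y)⟩

theorem surjective_of_interior_closure_image_ball [CompleteSpace X] (f : X →L[ℝ] Y) {r : ℝ}
    (h : (interior (closure (f '' ball 0 r))).Nonempty) : Function.Surjective f := by
  obtain ⟨a, ha⟩ := h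
  rw [mem_interior_iff_mem_nhds, Metric.mem_nhds_iff] at ha
  obtain ⟨δ, δpos, H⟩ := ha
  have approx : ∀ b ∈ ball a δ, ∃ x, ‖b - f x‖ < δ / 8 ∧ ‖x‖ < r := by
    intro b hb
    obtain ⟨_, ⟨x, hx, rfl⟩, hxb⟩ := Metric.mem_closure_iff.1 (H hb) (δ / 8) (by positivity)
    exact ⟨x, by rwa [← dist_eq_norm], by simpa using hx⟩
  refine f.surjective_of_approx_preimage (C := 2 / δ * (r + r)) fun y => ?_
  rcases eq_or_ne y 0 with rfl | hy
  · exact ⟨0, by simp⟩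
  have hy' : 0 < ‖y‖ := norm_pos_iff.2 hy
  -- Dividing by `t` gives `y` norm `δ / 2`, so both `a` and `a + t⁻¹ • y` lie in the ball.
  -- Subtracting their approximate preimages leaves an error of at most `t * (δ / 4) = ‖y‖ / 2`.
  set t : ℝ := 2 * ‖y‖ / δ with ht
  have tpos : 0 < t := by positivity
  have hz : ‖t⁻¹ • y‖ = δ / 2 := by
    rw [norm_smul, norm_inv, Real.norm_of_nonneg tpos.le, ht]
    field_simp
  obtain ⟨x₁, h₁, hx₁⟩ := approx (a + t⁻¹ • y) (by simp [hz, δpos])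
  obtain ⟨x₂, h₂, hx₂⟩ := approx a (by simpa using δpos)
  refine ⟨t • (x₁ - x₂), ?_, ?_⟩
  · have : y - f (t • (x₁ - x₂)) = t • ((a + t⁻¹ • y - f x₁) - (a - f x₂)) := by
      rw [map_smul, map_sub, smul_sub, smul_sub, smul_sub, smul_sub, smul_add,
        smul_inv_smul₀ tpos.ne']
      abel
    rw [this, norm_smul, Real.norm_of_nonneg tpos.le]
    calc t * ‖(a + t⁻¹ • y - f x₁) - (a - f x₂)‖ ≤ t * (δ / 8 + δ / 8) := by
          gcongr
          exact (norm_sub_le _ _).trans (add_le_add h₁.le h₂.le)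
      _ = 1 / 2 * ‖y‖ := by rw [ht]; field_simp; norm_num
  · rw [norm_smul, Real.norm_of_nonneg tpos.le]
    calc t * ‖x₁ - x₂‖ ≤ t * (r + r) := by
          gcongr
          exact (norm_sub_le _ _).trans (add_le_add hx₁.le hx₂.le)
      _ = 2 / δ * (r + r) * ‖y‖ := by rw [ht]; ring

end ContinuousLinearMap

/-! ### Families of dense open sets in separable complete metric spaces -/

section Cardinal

theorem dense_iInter_of_mk_lt_cardinalP {ι : Type v}
    (h : Cardinal.mk ι < Cardinal.lift.{v} cardinalP)
    {O : ι → Set ℝ} (ho : ∀ i, IsOpen (O i)) (hd : ∀ i, Dense (O i)) : Dense (⋂ i, O i) := by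
  obtain ⟨c, hc, hcι⟩ := Cardinal.lt_lift_iff.1 h
  have : Nonempty (ULift.{v} c.out ≃ ι) := by
    rw [← Cardinal.eq, Cardinal.mk_uLift, Cardinal.mk_out, hcι]
  obtain ⟨e⟩ := this
  by_contra hnd
  refine notMem_of_lt_csInf hc (OrderBot.bddBelow _)
    ⟨c.out, fun i => O (e ⟨i⟩), Cardinal.mk_out c, fun i => ⟨ho _, hd _⟩, ?_⟩
  rwa [← (Equiv.ulift.symm.trans e).surjective.iInter_comp O] at hnd

/-- This is Baire's theorem in `ℝ`. The hypothesis excludes the convention `sInf ∅ = 0`. -/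
theorem aleph0_lt_cardinalP (h : cardinalP ≠ 0) : Cardinal.aleph0 < cardinalP := by
  have hne : {c : Cardinal.{0} | ∃ (ι : Type) (U : ι → Set ℝ), Cardinal.mk ι = c ∧
      (∀ i, IsOpen (U i) ∧ Dense (U i)) ∧ ¬ Dense (⋂ i, U i)}.Nonempty := by
    by_contra hne
    rw [not_nonempty_iff_eq_empty] at hne
    exact h (by rw [cardinalP, hne, Cardinal.sInf_empty])
  obtain ⟨ι, U, hι, hU, hd⟩ := csInf_mem hne
  by_contra hle
  rw [not_lt, cardinalP, ← hι, Cardinal.mk_le_aleph0_iff] at hle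
  exact hd (dense_iInter_of_isOpen (fun i => (hU i).1) fun i => (hU i).2)

theorem aleph0_lt_lift_cardinalP {c : Cardinal.{v}} (h : c < Cardinal.lift.{v} cardinalP) :
    Cardinal.aleph0 < Cardinal.lift.{v} cardinalP := by
  rw [Cardinal.aleph0_lt_lift]
  refine aleph0_lt_cardinalP fun h0 => ?_
  rw [h0, Cardinal.lift_zero] at h
  exact not_lt_bot h

end Cardinal

/-! ### Coding decreasing sequences of sets by real numbers -/

section Decoding

variable {X : Type*}

open Classical in
/-- The set attached to the dyadic interval `(k / 2 ^ n, (k + 1) / 2 ^ n)`: the left half of an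
interval inherits its set; on the right half the set is replaced by the next candidate from the
sequence `V`, in which every term is tried infinitely often, provided the candidate is smaller. -/
def dyadicStage (V : ℕ → Set X) : ℕ → ℤ → Set X
  | 0, _ => univ
  | n + 1, k =>
    if Odd k ∧ V n.unpair.1 ⊆ dyadicStage V n (k / 2) then V n.unpair.1
    else dyadicStage V n (k / 2)

theorem dyadicStage_induction {V : ℕ → Set X} {p : Set X → Prop} (huniv : p univ)
    (hV : ∀ i, p (V i)) (n : ℕ) (k : ℤ) : p (dyadicStage V n k) := by
  induction n generalizing k with
  | zero => exact huniv
  | succ n ih =>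
    rw [dyadicStage]
    split_ifs
    exacts [hV _, ih _]

theorem dyadicStage_succ_subset (V : ℕ → Set X) (n : ℕ) (k : ℤ) :
    dyadicStage V (n + 1) k ⊆ dyadicStage V n (k / 2) := by
  rw [dyadicStage]
  split_ifs with h
  exacts [h.2, Subset.rfl]

theorem dyadicStage_mul_two_pow (V : ℕ → Set X) (n j : ℕ) (k : ℤ) :
    dyadicStage V (n + j) (k * 2 ^ j) = dyadicStage V n k := by
  induction j with
  | zero => simp
  | succ j ih =>
    have h2 : k * 2 ^ (j + 1) = 2 * (k * 2 ^ j) := by ring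
    rw [← Nat.add_assoc, dyadicStage, h2, if_neg (by simp), Int.mul_ediv_cancel_left _ two_ne_zero,
      ih]

/-- Candidate `i` is tried at step `Nat.pair i n`, which is not before `n`. Left halves keep the set
unchanged until then, and one right half selects `V i`. -/
theorem dyadicStage_right_half {V : ℕ → Set X} {i n j : ℕ} {k : ℤ} (hj : n + j = Nat.pair i n)
    (h : V i ⊆ dyadicStage V n k) :
    dyadicStage V (n + j + 1) (2 * (k * 2 ^ j) + 1) = V i := by
  have hk : (2 * (k * 2 ^ j) + 1) / 2 = k * 2 ^ j := by omega
  have hi : (n + j).unpair.1 = i := by rw [hj, Nat.unpair_pair]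
  rw [dyadicStage, hk, dyadicStage_mul_two_pow, hi, if_pos ⟨odd_two_mul_add_one _, h⟩]

/-- The reals at which some stage satisfies `P`. -/
def dyadicLocus (V : ℕ → Set X) (P : Set X → Prop) : Set ℝ :=
  ⋃ (n : ℕ) (k : ℤ) (_ : P (dyadicStage V n k)), Ioo (k / 2 ^ n : ℝ) ((k + 1) / 2 ^ n)

theorem isOpen_dyadicLocus (V : ℕ → Set X) (P : Set X → Prop) : IsOpen (dyadicLocus V P) :=
  isOpen_iUnion fun _ => isOpen_iUnion fun _ => isOpen_iUnion fun _ => isOpen_Ioo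

theorem dense_dyadicLocus {V : ℕ → Set X} {P : Set X → Prop}
    (h : ∀ n k, ∃ i, V i ⊆ dyadicStage V n k ∧ P (V i)) : Dense (dyadicLocus V P) := by
  refine Metric.dense_iff.2 fun x ε hε => ?_
  obtain ⟨n, hn⟩ := exists_pow_lt_of_lt_one hε (by norm_num : (1 / 2 : ℝ) < 1)
  obtain ⟨i, hi, hP⟩ := h n ⌊x * 2 ^ n⌋
  obtain ⟨j, hj⟩ := Nat.exists_eq_add_of_le (Nat.right_le_pair i n)
  have hst := dyadicStage_right_half hj.symm hi
  set k : ℤ := ⌊x * 2 ^ n⌋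
  have hk₁ : (k : ℝ) ≤ x * 2 ^ n := Int.floor_le _
  have hk₂ : x * 2 ^ n < k + 1 := Int.lt_floor_add_one _
  have hn0 : (0 : ℝ) < 2 ^ n := by positivity
  have hj0 : (1 : ℝ) ≤ 2 ^ j := one_le_pow₀ one_le_two
  have hj1 : (0 : ℝ) < 2 ^ j := by positivity
  -- This is the midpoint of the interval reached after `j` left halves and one right half.
  refine ⟨(k + 3 / 4 / 2 ^ j) / 2 ^ n, ?_, ?_⟩
  · have hq₁ : (3 / 4 / 2 ^ j : ℝ) < 1 := by rw [div_lt_one hj1]; linarith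
    have hq₀ : (0 : ℝ) < 3 / 4 / 2 ^ j := by positivity
    have : |(k + 3 / 4 / 2 ^ j) - x * 2 ^ n| < (1 : ℝ) := by rw [abs_lt]; constructor <;> linarith
    rw [mem_ball, Real.dist_eq]
    have he : (k + 3 / 4 / 2 ^ j : ℝ) / 2 ^ n - x = ((k + 3 / 4 / 2 ^ j) - x * 2 ^ n) / 2 ^ n := by
      field_simp
    rw [he, abs_div, abs_of_pos hn0]
    calc _ < 1 / (2 : ℝ) ^ n := by gcongr
      _ < ε := by rwa [← one_div_pow]
  · refine mem_iUnion.2 ⟨n + j + 1, mem_iUnion.2 ⟨2 * (k * 2 ^ j) + 1, mem_iUnion.2 ⟨?_, ?_⟩⟩⟩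
    · rwa [hst]
    · have he : (k + 3 / 4 / 2 ^ j : ℝ) / 2 ^ n
          = (2 * (k * 2 ^ j) + 3 / 2) / 2 ^ (n + j + 1) := by
        rw [pow_succ, pow_add]; field_simp; ring
      rw [he]
      push_cast
      constructor <;> exact div_lt_div_of_pos_right (by linarith) (by positivity)

/-- The decreasing sequence of sets decoded from the real number `x`. -/
def dyadicBranch (V : ℕ → Set X) (x : ℝ) (n : ℕ) : Set X := dyadicStage V n ⌊x * 2 ^ n⌋

theorem dyadicBranch_antitone (V : ℕ → Set X) (x : ℝ) : Antitone (dyadicBranch V x) := by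
  refine antitone_nat_of_succ_le fun n => ?_
  have h : ⌊x * 2 ^ (n + 1)⌋ / 2 = ⌊x * 2 ^ n⌋ := by
    have := Int.floor_div_natCast (x * 2 ^ (n + 1)) 2
    rw [Nat.cast_ofNat, Nat.cast_ofNat] at this
    rw [← this, pow_succ]
    congr 1
    ring
  rw [dyadicBranch, dyadicBranch, ← h]
  exact dyadicStage_succ_subset V n _

theorem exists_dyadicBranch_of_mem_dyadicLocus {V : ℕ → Set X} {P : Set X → Prop} {x : ℝ}
    (hx : x ∈ dyadicLocus V P) : ∃ n, P (dyadicBranch V x n) := by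
  simp only [dyadicLocus, mem_iUnion] at hx
  obtain ⟨n, k, hP, h₁, h₂⟩ := hx
  have hn0 : (0 : ℝ) < 2 ^ n := by positivity
  have hk : ⌊x * 2 ^ n⌋ = k :=
    Int.floor_eq_iff.2 ⟨((div_lt_iff₀ hn0).1 h₁).le, (lt_div_iff₀ hn0).1 h₂⟩
  exact ⟨n, by rwa [dyadicBranch, hk]⟩

end Decoding

/-! ### Baire category for fewer than `𝔭` sets in separable complete metric spaces -/

section Polish

variable {X : Type*} [PseudoMetricSpace X]

theorem exists_seq_closed_shrinking [TopologicalSpace.SeparableSpace X] [Nonempty X] :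
    ∃ V : ℕ → Set X, (∀ i, IsClosed (V i)) ∧ (∀ i, (interior (V i)).Nonempty) ∧
      ∀ O : Set X, IsOpen O → O.Nonempty → ∀ ε > 0, ∃ i, V i ⊆ O ∧
        ∀ x ∈ V i, ∀ y ∈ V i, dist x y ≤ ε := by
  refine ⟨fun m => closedBall (TopologicalSpace.denseSeq X m.unpair.1) (1 / (m.unpair.2 + 1)),
    fun _ => isClosed_closedBall, fun i => ?_, ?_⟩
  · exact ⟨_, ball_subset_interior_closedBall (mem_ball_self (by positivity))⟩
  · intro O hO hne ε hε
    obtain ⟨_, hpO, ⟨a, rfl⟩⟩ :=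
      (TopologicalSpace.denseRange_denseSeq X).inter_open_nonempty O hO hne
    obtain ⟨δ, hδ, hball⟩ := Metric.isOpen_iff.1 hO _ hpO
    obtain ⟨b, hb⟩ := exists_nat_one_div_lt (lt_min hδ (half_pos hε))
    refine ⟨Nat.pair a b, ?_, ?_⟩
    · beta_reduce
      rw [Nat.unpair_pair]
      exact (closedBall_subset_ball (hb.trans_le (min_le_left _ _))).trans hball
    · beta_reduce
      rw [Nat.unpair_pair]
      intro x hx y hy
      have h := hb.le.trans (min_le_right _ _)
      have := dist_triangle_right x y (TopologicalSpace.denseSeq X a)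
      rw [mem_closedBall] at hx hy
      simp only at hx hy
      linarith

theorem nonempty_iInter_of_antitone_isClosed [CompleteSpace X] {C : ℕ → Set X} (hC : Antitone C)
    (hc : ∀ n, IsClosed (C n)) (hne : ∀ n, (C n).Nonempty)
    (hd : ∀ ε > 0, ∃ n, ∀ x ∈ C n, ∀ y ∈ C n, dist x y < ε) : (⋂ n, C n).Nonempty := by
  choose u hu using hne
  have hmem : ∀ n m, n ≤ m → u m ∈ C n := fun n m h => hC h (hu m)
  have hcau : CauchySeq u := Metric.cauchySeq_iff'.2 fun ε hε => by
    obtain ⟨n, hn⟩ := hd ε hε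
    exact ⟨n, fun m hm => hn _ (hmem n m hm) _ (hu n)⟩
  obtain ⟨y, hy⟩ := cauchySeq_tendsto_of_complete hcau
  exact ⟨y, mem_iInter.2 fun n => (hc n).mem_of_tendsto hy (eventually_atTop.2 ⟨n, hmem n⟩)⟩

/-- In a nonempty separable complete metric space, fewer than `cardinalP` dense open sets have a
common point. -/
theorem nonempty_iInter_of_mk_lt_cardinalP {X J : Type v} [PseudoMetricSpace X] [CompleteSpace X]
    [TopologicalSpace.SeparableSpace X] [Nonempty X]
    (hJ : Cardinal.mk J < Cardinal.lift.{v} cardinalP) {U : J → Set X}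
    (ho : ∀ i, IsOpen (U i)) (hd : ∀ i, Dense (U i)) : (⋂ i, U i).Nonempty := by
  obtain ⟨V, hVc, hVi, hV⟩ := exists_seq_closed_shrinking (X := X)
  -- The requirements on a branch: enter each `U j`, and have arbitrarily small diameter. The second
  -- kind adds only `ℵ₀ < 𝔭` conditions.
  let P : J ⊕ ULift.{v} ℕ → Set X → Prop :=
    Sum.elim (fun j C => C ⊆ U j)
      (fun m C => ∀ x ∈ C, ∀ y ∈ C, dist x y ≤ 1 / ((m.down : ℝ) + 1))
  have hint : ∀ n k, (interior (dyadicStage V n k)).Nonempty :=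
    dyadicStage_induction (p := fun C => (interior C).Nonempty) (by simp) hVi
  -- Every stage has nonempty interior, so it can be shrunk to meet any single requirement.
  have hP : ∀ q n k, ∃ i, V i ⊆ dyadicStage V n k ∧ P q (V i) := by
    rintro (j | m) n k
    · obtain ⟨i, hi, -⟩ := hV (interior (dyadicStage V n k) ∩ U j) (isOpen_interior.inter (ho j))
        ((hd j).inter_open_nonempty _ isOpen_interior (hint n k)) 1 one_pos
      exact ⟨i, (hi.trans inter_subset_left).trans interior_subset, hi.trans inter_subset_right⟩
    · obtain ⟨i, hi, hdist⟩ := hV _ isOpen_interior (hint n k) (1 / ((m.down : ℝ) + 1))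
        (by positivity)
      exact ⟨i, hi.trans interior_subset, hdist⟩
  have haleph := aleph0_lt_lift_cardinalP hJ
  have hcard : Cardinal.mk (J ⊕ ULift.{v} ℕ) < Cardinal.lift.{v} cardinalP := by
    rw [Cardinal.mk_sum, Cardinal.lift_id, Cardinal.lift_id]
    exact Cardinal.add_lt_of_lt haleph.le hJ (by simpa using haleph)
  obtain ⟨x, hx⟩ := (dense_iInter_of_mk_lt_cardinalP hcard
    (fun q => isOpen_dyadicLocus V (P q)) fun q => dense_dyadicLocus (hP q)).nonempty
  have hbranch : ∀ q, ∃ n, P q (dyadicBranch V x n) := fun q =>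
    exists_dyadicBranch_of_mem_dyadicLocus (mem_iInter.1 hx q)
  obtain ⟨y, hy⟩ := nonempty_iInter_of_antitone_isClosed (dyadicBranch_antitone V x)
    (fun n => dyadicStage_induction isClosed_univ hVc n _)
    (fun n => (hint n _).mono interior_subset) fun ε hε => by
      obtain ⟨m, hm⟩ := exists_nat_one_div_lt hε
      obtain ⟨n, hn⟩ := hbranch (Sum.inr ⟨m⟩)
      exact ⟨n, fun a ha b hb => (hn a ha b hb).trans_lt hm⟩
  refine ⟨y, mem_iInter.2 fun j => ?_⟩
  obtain ⟨n, hn⟩ := hbranch (Sum.inl j)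
  exact hn (mem_iInter.1 hy n)

theorem exists_interior_nonempty_of_mk_lt_cardinalP {X J : Type v} [PseudoMetricSpace X]
    [CompleteSpace X] [TopologicalSpace.SeparableSpace X] [Nonempty X]
    (hJ : Cardinal.mk J < Cardinal.lift.{v} cardinalP) {f : J → Set X}
    (hc : ∀ i, IsClosed (f i)) (hU : ⋃ i, f i = univ) : ∃ i, (interior (f i)).Nonempty := by
  by_contra! hf
  obtain ⟨x, hx⟩ := nonempty_iInter_of_mk_lt_cardinalP hJ (U := fun i => (f i)ᶜ)
    (fun i => (hc i).isOpen_compl) fun i => interior_eq_empty_iff_dense_compl.1 (hf i)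
  rw [← compl_iUnion, hU] at hx
  exact hx trivial

end Polish

/-! ### Submodules generated by tuples -/

section Module

variable {A : Type u} [NonUnitalNormedRing A] [NormedSpace ℂ A]
  {E : Type v} [NormedAddCommGroup E] [NormedSpace ℂ E] [NormedRightModule A E]

variable (A) in
/-- The operator `(c, a) ↦ ∑ k, w k (c k, a k)` on tuples of elements of `A¹`. -/
noncomputable def tupleMap {n : ℕ} (w : Fin n → E) : (Fin n → ℂ × A) →L[ℂ] E :=
  ∑ k, ((ContinuousLinearMap.toSpanSingleton ℂ (w k)).coprod (NormedRightModule.act (w k))).comp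
    (ContinuousLinearMap.proj k)

theorem tupleMap_apply {n : ℕ} (w : Fin n → E) (a : Fin n → ℂ × A) :
    tupleMap A w a = ∑ k, unitizationAct (w k) (Unitization.inl (a k).1 + Unitization.inr (a k).2) := by
  simp [tupleMap, unitizationAct]

theorem tupleMap_mem {W : Submodule ℂ E} (hW : IsRightSubmodule A W) {n : ℕ} {w : Fin n → E}
    (hw : ∀ k, w k ∈ W) (a : Fin n → ℂ × A) : tupleMap A w a ∈ W := by
  rw [tupleMap_apply]
  exact sum_mem fun k _ => W.add_mem (W.smul_mem _ (hw k)) (hW _ (hw k) _)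

/-- A generated submodule is finitely generated if the tuple operators cannot cover it by closed
sets with empty interior. -/
theorem isAlgFinitelyGenerated_of_closed_cover [CompleteSpace A] {W : Submodule ℂ E}
    (hW : IsRightSubmodule A W) {S : Set E} (hS : IsAlgGeneratingSet A S W)
    (hbaire : ∀ C : (Σ n : ℕ, Fin n → S) × ℕ → Set W, (∀ i, IsClosed (C i)) →
      ⋃ i, C i = univ → ∃ i, (interior (C i)).Nonempty) :
    IsAlgFinitelyGenerated A W := by
  have hmem : ∀ (w : Σ n : ℕ, Fin n → S) k, (w.2 k : E) ∈ W := fun w k => hS.1 (w.2 k).2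
  let T : ∀ w : Σ n : ℕ, Fin n → S, (Fin w.1 → ℂ × A) →L[ℂ] W := fun w =>
    (tupleMap A fun k => (w.2 k : E)).codRestrict W (tupleMap_mem hW (hmem w))
  obtain ⟨⟨w, m⟩, hint⟩ := hbaire (fun i => closure (T i.1 '' ball 0 i.2))
    (fun _ => isClosed_closure) (by
      refine eq_univ_of_forall fun x => ?_
      obtain ⟨n, w, a, hw, hx⟩ := hS.2 x x.2
      let b : Fin n → ℂ × A := fun k => ((a k).fst, (a k).snd)
      obtain ⟨m, hm⟩ := exists_nat_gt ‖b‖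
      refine mem_iUnion.2 ⟨⟨⟨n, fun k => ⟨w k, hw k⟩⟩, m⟩, subset_closure ⟨b, by simpa using hm, ?_⟩⟩
      apply Subtype.ext
      rw [hx]
      exact (tupleMap_apply w b).trans
        (Finset.sum_congr rfl fun k _ => by rw [Unitization.inl_fst_add_inr_snd_eq]))
  have hsurj : Function.Surjective (T w) :=
    ((T w).restrictScalars ℝ).surjective_of_interior_closure_image_ball hint
  refine ⟨range fun k => (w.2 k : E), finite_range _, range_subset_iff.2 (hmem w), fun x hx => ?_⟩
  obtain ⟨a, ha⟩ := hsurj ⟨x, hx⟩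
  exact ⟨w.1, fun k => w.2 k, _, fun k => mem_range_self k,
    (congrArg Subtype.val ha).symm.trans (tupleMap_apply _ a)⟩

end Module

theorem corollary3p2 {A : Type u} [NonUnitalNormedRing A] [NormedSpace ℂ A]
    [IsScalarTower ℂ A A] [SMulCommClass ℂ A A] [CompleteSpace A]
    {E : Type v} [NormedAddCommGroup E] [NormedSpace ℂ E] [CompleteSpace E]
    [NormedRightModule A E]
    (W : Submodule ℂ E) (hW : IsRightSubmodule A W) (hclosed : IsClosed (W : Set E)) :
    (IsAlgCountablyGenerated A W → IsAlgFinitelyGenerated A W) ∧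
    (∀ κ : Cardinal.{v}, κ < Cardinal.lift.{v} cardinalP →
      TopologicalSpace.SeparableSpace W → IsAlgGenerated A κ W →
        IsAlgFinitelyGenerated A W) := by
  have : CompleteSpace W := hclosed.completeSpace_coe
  refine ⟨fun ⟨S, hcard, hS⟩ => ?_, fun κ hκ _ ⟨S, hcard, hS⟩ => ?_⟩
  · have : Countable S := Cardinal.mk_le_aleph0_iff.1 hcard
    exact isAlgFinitelyGenerated_of_closed_cover hW hS fun C hc hU =>
      nonempty_interior_of_iUnion_of_closed hc hU
  · have hSp := hcard.trans_lt hκ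
    have haleph := aleph0_lt_lift_cardinalP hSp
    -- Tuples from `S` are lists, so there are at most `max ℵ₀ |S|` of them, and the integer radii
    -- contribute a factor `ℵ₀`.
    have hcardJ : Cardinal.mk ((Σ n : ℕ, Fin n → S) × ℕ) < Cardinal.lift.{v} cardinalP := by
      rw [Cardinal.mk_prod, ← Cardinal.mk_congr List.equivSigmaTuple, Cardinal.mk_nat,
        Cardinal.lift_aleph0, Cardinal.lift_uzero]
      exact Cardinal.mul_lt_of_lt haleph.le
        ((Cardinal.mk_list_le_max S).trans_lt (max_lt haleph hSp)) haleph
    exact isAlgFinitelyGenerated_of_closed_cover hW hS fun C hc hU =>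
      exists_interior_nonempty_of_mk_lt_cardinalP hcardJ hc hU
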